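/- Let $n \ge 1$. **Posets.** The triangular poset $\mathcal D_n$ consists of the triples $(y_1,y_2,y_3)\in\mathbb N^3$ with $y_1+y_2+y_3=n-2$, ordered by $y \le z$ if and only if $y_1+y_2\le z_1+z_2$ and $y_2+y_3\le z_2+z_3$. The tetrahedron poset $\mathcal T_n$ consists of the quadruples $(x_1,x_2,x_3,x_4)\in\mathbb N^4$ with $x_1+x_2+x_3+x_4=n-2$, ordered by $x\le w$ if and only if $x_1\ge w_1$, $x_2\le w_2$, $x_3\le w_3$ and $x_4\ge w_4$. (Both are empty if $n=1$.) A *wall* is a subset of $\mathcal T_n$ which, with the induced order, is isomorphic to $\mathcal D_n$. **Depth triangles.** A *depth triangle* of order $n$ is a map $\delta:\mathcal D_n\to\mathbb Z$ such that $\delta(y_1,0,y_3)=0$ for all $(y_1,0,y_3)\in\mathcal D_n$, and $|\delta(y_1,y_2,y_3)-\delta(y_1,y_2-1,y_3+1)|=1=|\delta(y_1,y_2,y_3)-\delta(y_1+1,y_2-1,y_3)|$ for all $(y_1,y_2,y_3)\in\mathcal D_n$ with $y_2\ge 1$. **Catalan congruences.** Let $\mathbf{ASM}_n$ be the set of $n\times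 n$ alternating sign matrices (entries in $\{-1,0,1\}$, row and column sums equal to $1$, nonzero entries alternating in sign along each row and each column), ordered by entrywise comparison of their height functions $H_{i,j}=i+j-2\sum_{i'\le i,\,j'\le j}A_{i',j'}$, $0\le i,j\le n$; this is a lattice, in which joins and meets are entrywise maxima and minima of height functions. Let $\mathbf{Dyck}_n$ be the set of Dyck paths of semilength $n$, where $P\le Q$ if $P$ stays weakly below $Q$ (the Stanley lattice). A *catalan congruence* is a lattice congruence $\equiv$ of $\mathbf{ASM}_n$ whose quotient $\mathbf{ASM}_n/{\equiv}$ is isomorphic to $\mathbf{Dyck}_n$; here a class $X$ is below a class $Y$ if some $x\in X$ and $y\in Y$ satisfy $x\le y$. For $x\in\mathcal T_n$, let $j(x)\in\mathbf{ASM}_n$ be the permutation matrix $$j(x)=\begin{pmatrix} I_{x_1}&0&0&0\\0&0&I_{x_2+1}&0\\0&I_{x_3+1}&0&0\\0&0&0&I_{x_4}\end{pmatrix}.$$ For a congruence $\equiv$ of $\mathbf{ASM}_n$, let $W(\equiv)$ be the set of $x\in\mathcal T_n$ such that $j(x)$ covers a single element $j(x)_\star$ of $\mathbf{ASM}_n$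 and $j(x)\not\equiv j(x)_\star$. **Theorem.** 1. For every wall $P\subseteq\mathcal T_n$ and every $y\in\mathcal D_n$, there is exactly one $x\in P$ with $(x_1,x_2+x_3,x_4)=y$. 2. The catalan congruences of $\mathbf{ASM}_n$ are in bijection with the depth triangles of order $n$. More precisely, there is a bijection ${\equiv}\mapsto\delta_\equiv$ from the catalan congruences of $\mathbf{ASM}_n$ to the depth triangles of order $n$ such that, for every catalan congruence $\equiv$, the set $W(\equiv)$ is a wall, and a point $x\in\mathcal T_n$ belongs to $W(\equiv)$ if and only if $\delta_\equiv(x_1,x_2+x_3,x_4)=x_3-x_2$. -/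

import Mathlib

namespace CatalanASM

/-! ### The triangular poset and the tetrahedron poset -/

/-- Elements of the triangular poset `D_n`: triples of natural numbers with sum `n - 2`
(there are none when `n < 2`). -/
@[ext]
structure TrianglePoset (n : ℕ) where
  y1 : ℕ
  y2 : ℕ
  y3 : ℕ
  sum_eq : y1 + y2 + y3 + 2 = n

instance (n : ℕ) : PartialOrder (TrianglePoset n) where
  le y z := y.y1 + y.y2 ≤ z.y1 + z.y2 ∧ y.y2 + y.y3 ≤ z.y2 + z.y3
  le_refl _ := ⟨le_rfl, le_rfl⟩
  le_trans _ _ _ h k := ⟨h.1.trans k.1, h.2.trans k.2⟩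
  le_antisymm y z h k := by
    have := y.sum_eq
    have := z.sum_eq
    obtain ⟨h1, h2⟩ := h
    obtain ⟨k1, k2⟩ := k
    ext <;> omega

/-- Elements of the tetrahedron poset `T_n`: quadruples of natural numbers with sum `n - 2`
(there are none when `n < 2`). -/
@[ext]
structure TetraPoset (n : ℕ) where
  x1 : ℕ
  x2 : ℕ
  x3 : ℕ
  x4 : ℕ
  sum_eq : x1 + x2 + x3 + x4 + 2 = n

instance (n : ℕ) : PartialOrder (TetraPoset n) where
  le x y := y.x1 ≤ x.x1 ∧ x.x2 ≤ y.x2 ∧ x.x3 ≤ y.x3 ∧ y.x4 ≤ x.x4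
  le_refl _ := ⟨le_rfl, le_rfl, le_rfl, le_rfl⟩
  le_trans _ _ _ h k :=
    ⟨k.1.trans h.1, h.2.1.trans k.2.1, h.2.2.1.trans k.2.2.1, k.2.2.2.trans h.2.2.2⟩
  le_antisymm _ _ h k :=
    TetraPoset.ext (le_antisymm k.1 h.1) (le_antisymm h.2.1 k.2.1)
      (le_antisymm h.2.2.1 k.2.2.1) (le_antisymm k.2.2.2 h.2.2.2)

/-- The projection `(x1, x2, x3, x4) ↦ (x1, x2 + x3, x4)`. -/
def TetraPoset.proj {n : ℕ} (x : TetraPoset n) : TrianglePoset n where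
  y1 := x.x1
  y2 := x.x2 + x.x3
  y3 := x.x4
  sum_eq := by have := x.sum_eq; omega

/-- A wall is a subposet of `T_n` (a subset with the induced order) isomorphic to `D_n`. -/
def IsWall {n : ℕ} (P : Set (TetraPoset n)) : Prop :=
  Nonempty (P ≃o TrianglePoset n)

/-! ### Depth triangles -/

/-- Depth triangles of order `n`: the bottom row vanishes, and each entry differs by exactly `1`
from the two entries `(y1, y2 - 1, y3 + 1)` and `(y1 + 1, y2 - 1, y3)` below it. -/
structure IsDepthTriangle {n : ℕ} (d : TrianglePoset n → ℤ) : Prop where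
  bottom : ∀ y, y.y2 = 0 → d y = 0
  right : ∀ y z, z.y1 = y.y1 → z.y2 + 1 = y.y2 → z.y3 = y.y3 + 1 → |d y - d z| = 1
  left : ∀ y z, z.y1 = y.y1 + 1 → z.y2 + 1 = y.y2 → z.y3 = y.y3 → |d y - d z| = 1

def DepthTriangle (n : ℕ) : Type :=
  {d : TrianglePoset n → ℤ // IsDepthTriangle d}

/-! ### The Stanley lattice on Dyck paths -/

/-- Dyck paths of semilength `n`, given by their words of up and down steps. -/
@[ext]
structure DyckPath (n : ℕ) where
  word : DyckWord
  semilength_eq : word.semilength = n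

/-- The height of a Dyck path after its first `k` steps. -/
def DyckPath.height {n : ℕ} (p : DyckPath n) (k : ℕ) : ℤ :=
  ((p.word.toList.take k).count DyckStep.U : ℤ) - ((p.word.toList.take k).count DyckStep.D : ℤ)

theorem DyckPath.height_injective {n : ℕ} :
    Function.Injective (DyckPath.height : DyckPath n → ℕ → ℤ) := by
  intro p q h
  have hp := p.word.two_mul_semilength_eq_length
  have hq := q.word.two_mul_semilength_eq_length
  rw [p.semilength_eq] at hp
  rw [q.semilength_eq] at hq
  ext1
  ext1
  apply List.ext_getElem (hp.symm.trans hq)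
  intro k hk hk'
  have h0 := congrFun h k
  have h1 := congrFun h (k + 1)
  simp only [DyckPath.height, List.take_add_one, List.getElem?_eq_getElem hk,
    List.getElem?_eq_getElem hk', Option.toList_some, List.count_append,
    List.count_singleton'] at h0 h1
  rcases (p.word.toList[k]).dichotomy with a | a <;>
    rcases (q.word.toList[k]).dichotomy with b | b <;>
    simp only [a, b] at h1 ⊢ <;> simp at h1 <;> omega

/-- The order of the Stanley lattice: `p ≤ q` when `p` stays weakly below `q`. -/
noncomputable instance (n : ℕ) : PartialOrder (DyckPath n) :=
  PartialOrder.lift DyckPath.height DyckPath.height_injective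

/-! ### Alternating sign matrices and height function matrices -/

/-- The nonzero entries of `v` alternate in sign: two consecutive nonzero entries are opposite. -/
def Alternates {n : ℕ} (v : Fin n → ℤ) : Prop :=
  ∀ j k, j < k → v j ≠ 0 → v k ≠ 0 → (∀ l, j < l → l < k → v l = 0) → v k = - v j

structure IsASM {n : ℕ} (A : Matrix (Fin n) (Fin n) ℤ) : Prop where
  entry : ∀ i j, A i j = -1 ∨ A i j = 0 ∨ A i j = 1
  row_sum : ∀ i, ∑ j, A i j = 1
  col_sum : ∀ j, ∑ i, A i j = 1
  row_alternates : ∀ i, Alternates fun j => A i j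
  col_alternates : ∀ j, Alternates fun i => A i j

/-- Alternating sign matrices of order `n`. -/
def ASM (n : ℕ) : Type :=
  {A : Matrix (Fin n) (Fin n) ℤ // IsASM A}

structure IsHFM {n : ℕ} (H : Fin (n + 1) → Fin (n + 1) → ℤ) : Prop where
  first_row : ∀ j, H 0 j = (j : ℕ)
  first_col : ∀ i, H i 0 = (i : ℕ)
  last_row : ∀ j, H (Fin.last n) j = (n : ℤ) - (j : ℕ)
  last_col : ∀ i, H i (Fin.last n) = (n : ℤ) - (i : ℕ)
  row_step : ∀ (i : Fin (n + 1)) (j : Fin n), |H i j.succ - H i j.castSucc| = 1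
  col_step : ∀ (i : Fin n) (j : Fin (n + 1)), |H i.succ j - H i.castSucc j| = 1

/-- Height function matrices of order `n`. -/
def HFM (n : ℕ) : Type :=
  {H : Fin (n + 1) → Fin (n + 1) → ℤ // IsHFM H}

theorem abs_one_iff {a : ℤ} : |a| = 1 ↔ a = 1 ∨ a = -1 :=
  abs_eq zero_le_one

theorem IsHFM.parity {n : ℕ} {H : Fin (n + 1) → Fin (n + 1) → ℤ} (h : IsHFM H)
    (i j : Fin (n + 1)) : ∃ m : ℤ, H i j = (i : ℕ) + (j : ℕ) + 2 * m := by
  induction j using Fin.induction with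
  | zero => exact ⟨0, by rw [h.first_col]; simp⟩
  | succ j ih =>
    obtain ⟨m, hm⟩ := ih
    rcases abs_one_iff.1 (h.row_step i j) with e | e
    · exact ⟨m, by simp at hm ⊢; linarith⟩
    · exact ⟨m - 1, by simp at hm ⊢; linarith⟩

theorem IsHFM.sup {n : ℕ} {H K : Fin (n + 1) → Fin (n + 1) → ℤ} (h : IsHFM H) (k : IsHFM K) :
    IsHFM (H ⊔ K) where
  first_row j := by simp [h.first_row, k.first_row]
  first_col j := by simp [h.first_col, k.first_col]
  last_row j := by simp [h.last_row, k.last_row]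
  last_col j := by simp [h.last_col, k.last_col]
  row_step i j := by
    have h1 := abs_one_iff.1 (h.row_step i j)
    have k1 := abs_one_iff.1 (k.row_step i j)
    obtain ⟨a, ha⟩ := h.parity i j.castSucc
    obtain ⟨b, hb⟩ := k.parity i j.castSucc
    simp only [Pi.sup_apply, abs_one_iff]
    omega
  col_step i j := by
    have h1 := abs_one_iff.1 (h.col_step i j)
    have k1 := abs_one_iff.1 (k.col_step i j)
    obtain ⟨a, ha⟩ := h.parity i.castSucc j
    obtain ⟨b, hb⟩ := k.parity i.castSucc j
    simp only [Pi.sup_apply, abs_one_iff]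
    omega

theorem IsHFM.inf {n : ℕ} {H K : Fin (n + 1) → Fin (n + 1) → ℤ} (h : IsHFM H) (k : IsHFM K) :
    IsHFM (H ⊓ K) where
  first_row j := by simp [h.first_row, k.first_row]
  first_col j := by simp [h.first_col, k.first_col]
  last_row j := by simp [h.last_row, k.last_row]
  last_col j := by simp [h.last_col, k.last_col]
  row_step i j := by
    have h1 := abs_one_iff.1 (h.row_step i j)
    have k1 := abs_one_iff.1 (k.row_step i j)
    obtain ⟨a, ha⟩ := h.parity i j.castSucc
    obtain ⟨b, hb⟩ := k.parity i j.castSucc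
    simp only [Pi.inf_apply, abs_one_iff]
    omega
  col_step i j := by
    have h1 := abs_one_iff.1 (h.col_step i j)
    have k1 := abs_one_iff.1 (k.col_step i j)
    obtain ⟨a, ha⟩ := h.parity i.castSucc j
    obtain ⟨b, hb⟩ := k.parity i.castSucc j
    simp only [Pi.inf_apply, abs_one_iff]
    omega

/-- The lattice of height function matrices: entrywise order, maximum and minimum. -/
instance (n : ℕ) : Lattice (HFM n) :=
  Subtype.lattice (P := fun H : Fin (n + 1) → Fin (n + 1) → ℤ => IsHFM H)
    (fun _ _ h k => h.sup k) (fun _ _ h k => h.inf k)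

/-- The sum of the first `i` entries of `v`. -/
def partialSum {n : ℕ} (v : Fin n → ℤ) (i : Fin (n + 1)) : ℤ :=
  ∑ r : Fin n with r.castSucc < i, v r

theorem partialSum_zero {n : ℕ} (v : Fin n → ℤ) : partialSum v 0 = 0 := by
  simp [partialSum]

theorem partialSum_succ {n : ℕ} (v : Fin n → ℤ) (k : Fin n) :
    partialSum v k.succ = partialSum v k.castSucc + v k := by
  have : (Finset.univ.filter fun r : Fin n => r.castSucc < k.succ) =
      insert k (Finset.univ.filter fun r : Fin n => r.castSucc < k.castSucc) := by
    ext r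
    simp only [Finset.mem_filter, Finset.mem_univ, true_and, Finset.mem_insert, Fin.lt_def,
      Fin.val_castSucc, Fin.val_succ, Fin.ext_iff]
    omega
  rw [partialSum, this, Finset.sum_insert (by simp), add_comm, partialSum]

theorem partialSum_last {n : ℕ} (v : Fin n → ℤ) : partialSum v (Fin.last n) = ∑ r, v r := by
  simp [partialSum, Fin.castSucc_lt_last]

/-- Corner sums: the sum of the entries in the first `i` rows and the first `j` columns. -/
def cornerSum {n : ℕ} (A : Matrix (Fin n) (Fin n) ℤ) (i j : Fin (n + 1)) : ℤ :=
  ∑ r : Fin n with r.castSucc < i, ∑ s : Fin n with s.castSucc < j, A r s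

/-- The height function of a matrix with corner sums `C`, with entries `i + j - 2 * C i j`. -/
def heightMatrix {n : ℕ} (A : Matrix (Fin n) (Fin n) ℤ) (i j : Fin (n + 1)) : ℤ :=
  (i : ℕ) + (j : ℕ) - 2 * cornerSum A i j

/-- The matrix recovered from a height function by second differences. -/
def ofHeight {n : ℕ} (H : Fin (n + 1) → Fin (n + 1) → ℤ) : Matrix (Fin n) (Fin n) ℤ :=
  Matrix.of fun r s => (H r.succ s.castSucc + H r.castSucc s.succ
    - H r.succ s.succ - H r.castSucc s.castSucc) / 2

theorem cornerSum_eq {n : ℕ} (A : Matrix (Fin n) (Fin n) ℤ) (i j : Fin (n + 1)) :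
    cornerSum A i j = partialSum (fun r => partialSum (fun s => A r s) j) i := rfl

theorem cornerSum_eq' {n : ℕ} (A : Matrix (Fin n) (Fin n) ℤ) (i j : Fin (n + 1)) :
    cornerSum A i j = partialSum (fun s => partialSum (fun r => A r s) i) j :=
  Finset.sum_comm

theorem alternates_of_partialSum {n : ℕ} {v : Fin n → ℤ}
    (h : ∀ i, partialSum v i = 0 ∨ partialSum v i = 1) :
    (∀ i, v i = -1 ∨ v i = 0 ∨ v i = 1) ∧ Alternates v := by
  refine ⟨fun i => ?_, fun j k hjk hj hk hz => ?_⟩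
  · have := partialSum_succ v i
    have := h i.succ
    have := h i.castSucc
    omega
  · have key : ∀ m : Fin (n + 1), j.succ ≤ m → m ≤ k.castSucc →
        partialSum v m = partialSum v j.succ := by
      intro m
      induction m using Fin.induction with
      | zero => intro h1; simp at h1
      | succ m ih =>
        intro h1 h2
        rcases h1.eq_or_lt with e | e
        · rw [e]
        · have hjm : j < m := by simpa using e
          have hmk : m < k := by
            simp only [Fin.le_def, Fin.lt_def, Fin.val_succ, Fin.val_castSucc] at h2 ⊢
            omega
          rw [partialSum_succ, hz m hjm hmk, add_zero]
          apply ih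
          · simp only [Fin.le_def, Fin.lt_def, Fin.val_succ, Fin.val_castSucc] at hjm ⊢
            omega
          · simp only [Fin.le_def, Fin.lt_def, Fin.val_castSucc] at hmk ⊢
            omega
    have e := key k.castSucc
      (by simp only [Fin.le_def, Fin.lt_def, Fin.val_succ, Fin.val_castSucc] at hjk ⊢; omega)
      le_rfl
    have := partialSum_succ v j
    have := partialSum_succ v k
    have := h j.succ
    have := h j.castSucc
    have := h k.succ
    omega

theorem partialSum_of_alternates {n : ℕ} {v : Fin n → ℤ}
    (hv : ∀ i, v i = -1 ∨ v i = 0 ∨ v i = 1) (hs : ∑ i, v i = 1) (ha : Alternates v)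
    (i : Fin (n + 1)) : partialSum v i = 0 ∨ partialSum v i = 1 := by
  have key : ∀ m : Fin (n + 1),
      ((∀ l : Fin n, l.castSucc < m → v l = 0) ∧ ∀ i ≤ m, partialSum v i = 0) ∨
      ∃ e : ℤ, (e = 1 ∨ e = -1) ∧ (∀ i ≤ m, partialSum v i = 0 ∨ partialSum v i = e) ∧
        ∃ l : Fin n, l.castSucc < m ∧ (∀ t : Fin n, l < t → t.castSucc < m → v t = 0) ∧
          ((v l = e ∧ partialSum v m = e) ∨ (v l = -e ∧ partialSum v m = 0)) := by
    intro m
    induction m using Fin.induction with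
    | zero =>
      left
      refine ⟨fun l hl => by simp at hl, fun i hi => ?_⟩
      rw [Fin.le_zero_iff.1 hi, partialSum_zero]
    | succ m ih =>
      have hsucc := partialSum_succ v m
      have hlt : ∀ l : Fin n, l.castSucc < m.succ → l = m ∨ l.castSucc < m.castSucc := by
        intro l hl
        simp only [Fin.lt_def, Fin.val_succ, Fin.val_castSucc, Fin.ext_iff] at hl ⊢
        omega
      have hle : ∀ i : Fin (n + 1), i ≤ m.succ → i = m.succ ∨ i ≤ m.castSucc := by
        intro i hi
        simp only [Fin.le_def, Fin.val_succ, Fin.val_castSucc, Fin.ext_iff] at hi ⊢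
        omega
      rcases ih with ⟨hz, h0⟩ | ⟨e, he, hS, l, hl, hz, hc⟩
      · have hm := h0 _ le_rfl
        rcases eq_or_ne (v m) 0 with h | h
        · left
          refine ⟨fun l hl => ?_, fun i hi => ?_⟩
          · rcases hlt l hl with rfl | h'
            · exact h
            · exact hz l h'
          · rcases hle i hi with rfl | h'
            · omega
            · exact h0 i h'
        · right
          refine ⟨v m, by have := hv m; omega, fun i hi => ?_, m, Fin.castSucc_lt_succ,
            fun t h1 h2 => ?_, Or.inl ⟨rfl, by omega⟩⟩
          · rcases hle i hi with rfl | h'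
            · right; omega
            · exact Or.inl (h0 i h')
          · rcases hlt t h2 with rfl | h'
            · exact absurd h1 (lt_irrefl _)
            · exact absurd (Fin.castSucc_lt_castSucc_iff.1 h') h1.asymm
      · right
        rcases eq_or_ne (v m) 0 with h | h
        · refine ⟨e, he, fun i hi => ?_, l, hl.trans Fin.castSucc_lt_succ, fun t h1 h2 => ?_, ?_⟩
          · rcases hle i hi with rfl | h'
            · rw [hsucc, h, add_zero]; exact hS _ le_rfl
            · exact hS i h'
          · rcases hlt t h2 with rfl | h'
            · exact h
            · exact hz t h1 h'
          · rw [hsucc, h, add_zero]; exact hc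
        · have hlm : l < m := Fin.castSucc_lt_castSucc_iff.1 hl
          have halt : v m = - v l := ha l m hlm (by omega) h
            (fun t h1 h2 => hz t h1 (Fin.castSucc_lt_castSucc_iff.2 h2))
          refine ⟨e, he, fun i hi => ?_, m, Fin.castSucc_lt_succ, fun t h1 h2 => ?_, by omega⟩
          · rcases hle i hi with rfl | h'
            · omega
            · exact hS i h'
          · rcases hlt t h2 with rfl | h'
            · exact absurd h1 (lt_irrefl _)
            · exact absurd (Fin.castSucc_lt_castSucc_iff.1 h') h1.asymm
  have hlast := partialSum_last v
  rw [hs] at hlast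
  rcases key (Fin.last n) with ⟨-, h0⟩ | ⟨e, he, hS, -⟩
  · exact Or.inl (h0 i (Fin.le_last i))
  · have := hS _ le_rfl
    have := hS i (Fin.le_last i)
    omega

theorem partialSum_one {n : ℕ} {v : Fin n → ℤ} (hv : ∀ r, v r = 1) (i : Fin (n + 1)) :
    partialSum v i = (i : ℕ) := by
  induction i using Fin.induction with
  | zero => simp [partialSum_zero]
  | succ i ih => rw [partialSum_succ, ih, hv]; simp

theorem partialSum_const_zero {n : ℕ} {v : Fin n → ℤ} (hv : ∀ r, v r = 0) (i : Fin (n + 1)) :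
    partialSum v i = 0 := by
  simp [partialSum, hv]

theorem IsASM.isHFM {n : ℕ} {A : Matrix (Fin n) (Fin n) ℤ} (h : IsASM A) :
    IsHFM (heightMatrix A) where
  first_row j := by simp [heightMatrix, cornerSum_eq, partialSum_zero]
  first_col i := by simp [heightMatrix, cornerSum_eq', partialSum_zero]
  last_row j := by
    rw [heightMatrix, cornerSum_eq',
      partialSum_one (fun s => by rw [partialSum_last]; exact h.col_sum s)]
    simp only [Fin.val_last]
    ring
  last_col i := by
    rw [heightMatrix, cornerSum_eq,
      partialSum_one (fun s => by rw [partialSum_last]; exact h.row_sum s)]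
    simp only [Fin.val_last]
    ring
  row_step i j := by
    have h1 := partialSum_of_alternates (fun r => h.entry r j) (h.col_sum j)
      (h.col_alternates j) i
    simp only [heightMatrix, cornerSum_eq', partialSum_succ, Fin.val_succ, Fin.val_castSucc]
    push_cast
    rw [abs_one_iff]
    omega
  col_step i j := by
    have h1 := partialSum_of_alternates (v := fun s => A i s) (fun r => h.entry i r) (h.row_sum i)
      (h.row_alternates i) j
    simp only [heightMatrix, cornerSum_eq, partialSum_succ, Fin.val_succ, Fin.val_castSucc]
    push_cast
    rw [abs_one_iff]
    omega

theorem IsHFM.partialSum_row {n : ℕ} {H : Fin (n + 1) → Fin (n + 1) → ℤ} (h : IsHFM H)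
    (r : Fin n) (j : Fin (n + 1)) :
    2 * partialSum (fun s => ofHeight H r s) j = 1 - (H r.succ j - H r.castSucc j) := by
  induction j using Fin.induction with
  | zero => rw [partialSum_zero, h.first_col, h.first_col]; simp
  | succ j ih =>
    have h1 := abs_one_iff.1 (h.col_step r j.castSucc)
    have h2 := abs_one_iff.1 (h.col_step r j.succ)
    rw [partialSum_succ]
    simp only [ofHeight, Matrix.of_apply] at ih ⊢
    omega

theorem IsHFM.partialSum_col {n : ℕ} {H : Fin (n + 1) → Fin (n + 1) → ℤ} (h : IsHFM H)
    (s : Fin n) (i : Fin (n + 1)) :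
    2 * partialSum (fun r => ofHeight H r s) i = 1 - (H i s.succ - H i s.castSucc) := by
  induction i using Fin.induction with
  | zero => rw [partialSum_zero, h.first_row, h.first_row]; simp
  | succ i ih =>
    have h1 := abs_one_iff.1 (h.row_step i.castSucc s)
    have h2 := abs_one_iff.1 (h.row_step i.succ s)
    rw [partialSum_succ]
    simp only [ofHeight, Matrix.of_apply] at ih ⊢
    omega

theorem IsHFM.isASM {n : ℕ} {H : Fin (n + 1) → Fin (n + 1) → ℤ} (h : IsHFM H) :
    IsASM (ofHeight H) where
  entry i := (alternates_of_partialSum (v := fun j => ofHeight H i j) fun j => by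
    have := h.partialSum_row i j
    have := abs_one_iff.1 (h.col_step i j)
    omega).1
  row_alternates i := (alternates_of_partialSum (v := fun j => ofHeight H i j) fun j => by
    have := h.partialSum_row i j
    have := abs_one_iff.1 (h.col_step i j)
    omega).2
  col_alternates j := (alternates_of_partialSum (v := fun i => ofHeight H i j) fun i => by
    have := h.partialSum_col j i
    have := abs_one_iff.1 (h.row_step i j)
    omega).2
  row_sum i := by
    have h1 := h.partialSum_row i (Fin.last n)
    rw [partialSum_last, h.last_col, h.last_col, Fin.val_succ, Fin.val_castSucc] at h1
    push_cast at h1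
    omega
  col_sum j := by
    have h1 := h.partialSum_col j (Fin.last n)
    rw [partialSum_last, h.last_row, h.last_row, Fin.val_succ, Fin.val_castSucc] at h1
    push_cast at h1
    omega

theorem ofHeight_heightMatrix {n : ℕ} (A : Matrix (Fin n) (Fin n) ℤ) :
    ofHeight (heightMatrix A) = A := by
  ext r s
  simp only [ofHeight, Matrix.of_apply, heightMatrix, cornerSum_eq, partialSum_succ,
    Fin.val_succ, Fin.val_castSucc]
  push_cast
  omega

theorem IsHFM.heightMatrix_ofHeight {n : ℕ} {H : Fin (n + 1) → Fin (n + 1) → ℤ} (h : IsHFM H) :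
    heightMatrix (ofHeight H) = H := by
  funext i j
  induction i using Fin.induction with
  | zero => rw [heightMatrix, cornerSum_eq, partialSum_zero, h.first_row]; simp
  | succ i ih =>
    have h1 := h.partialSum_row i j
    simp only [heightMatrix, cornerSum_eq, partialSum_succ, Fin.val_succ, Fin.val_castSucc]
      at ih ⊢
    push_cast
    omega

/-- The bijection between alternating sign matrices and height function matrices. -/
def asmEquivHFM (n : ℕ) : ASM n ≃ HFM n where
  toFun A := ⟨heightMatrix A.1, A.2.isHFM⟩
  invFun H := ⟨ofHeight H.1, H.2.isASM⟩
  left_inv A := Subtype.ext (ofHeight_heightMatrix A.1)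
  right_inv H := Subtype.ext H.2.heightMatrix_ofHeight

/-- The lattice of alternating sign matrices, transported from the lattice of height function
matrices. -/
instance (n : ℕ) : Lattice (ASM n) := (asmEquivHFM n).lattice

/-! ### Catalan congruences -/

/-- The quotient of a lattice by a congruence. -/
def LatticeQuotient {L : Type*} [Lattice L] (c : LatticeCon L) : Type _ :=
  Quotient c.toSetoid

/-- A class `X` is below a class `Y` if some representative of `X` is below some representative
of `Y`. -/
instance {L : Type*} [Lattice L] (c : LatticeCon L) : LE (LatticeQuotient c) where
  le X Y := ∃ x y : L, Quotient.mk c.toSetoid x = X ∧ Quotient.mk c.toSetoid y = Y ∧ x ≤ y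

/-- Catalan congruences: the quotient is isomorphic to the Stanley lattice. -/
def CatalanCongruence (n : ℕ) : Type :=
  {c : LatticeCon (ASM n) // Nonempty (LatticeQuotient c ≃o DyckPath n)}

/-! ### Bigrassmannian permutations and the wall of a congruence -/

theorem isASM_of_perm {n : ℕ} (σ : Equiv.Perm (Fin n)) :
    IsASM (Matrix.of fun i j : Fin n => if σ i = j then (1 : ℤ) else 0) where
  entry i j := by simp only [Matrix.of_apply]; split_ifs <;> simp
  row_sum i := by simp
  col_sum j := by simp [← Equiv.eq_symm_apply]
  row_alternates i j k hjk hj hk _ := by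
    simp only [Matrix.of_apply, ne_eq, ite_eq_right_iff, one_ne_zero, imp_false, not_not] at hj hk
    exact absurd (hj.symm.trans hk) hjk.ne
  col_alternates i j k hjk hj hk _ := by
    simp only [Matrix.of_apply, ne_eq, ite_eq_right_iff, one_ne_zero, imp_false, not_not] at hj hk
    exact absurd (σ.injective (hj.trans hk.symm)) hjk.ne

/-- The matrix of a permutation, with entries `1` at the positions `(i, σ i)`. -/
def ASM.ofPerm {n : ℕ} (σ : Equiv.Perm (Fin n)) : ASM n :=
  ⟨Matrix.of fun i j => if σ i = j then 1 else 0, isASM_of_perm σ⟩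

/-- The bigrassmannian permutation of `x`: it fixes the first `x1` and the last `x4` points,
shifts the next `x2 + 1` points up by `x3 + 1`, and the next `x3 + 1` points down by `x2 + 1`. -/
def bigrassmannian {n : ℕ} (x : TetraPoset n) : Equiv.Perm (Fin n) where
  toFun i :=
    ⟨if i.1 < x.x1 then i.1
      else if i.1 < x.x1 + (x.x2 + 1) then i.1 + (x.x3 + 1)
      else if i.1 < x.x1 + (x.x2 + 1) + (x.x3 + 1) then i.1 - (x.x2 + 1)
      else i.1, by have := x.sum_eq; have := i.2; split_ifs <;> omega⟩
  invFun j :=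
    ⟨if j.1 < x.x1 then j.1
      else if j.1 < x.x1 + (x.x3 + 1) then j.1 + (x.x2 + 1)
      else if j.1 < x.x1 + (x.x3 + 1) + (x.x2 + 1) then j.1 - (x.x3 + 1)
      else j.1, by have := x.sum_eq; have := j.2; split_ifs <;> omega⟩
  left_inv i := by
    have := x.sum_eq
    have := i.2
    apply Fin.ext
    simp only
    split_ifs <;> omega
  right_inv j := by
    have := x.sum_eq
    have := j.2
    apply Fin.ext
    simp only
    split_ifs <;> omega

/-- The join irreducible alternating sign matrix `j(x)` of a point `x` of the tetrahedron. -/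
def joinIrred {n : ℕ} (x : TetraPoset n) : ASM n :=
  ASM.ofPerm (bigrassmannian x)

/-- `a` covers a single element `b`, and `a` is not congruent to `b`. -/
def IsNonContracted {L : Type*} [Lattice L] (c : LatticeCon L) (a : L) : Prop :=
  ∃ b, (∀ b', b' ⋖ a ↔ b' = b) ∧ ¬ c.r a b

/-- The points of the tetrahedron whose join irreducible is not contracted by the congruence. -/
def wallOf {n : ℕ} (c : LatticeCon (ASM n)) : Set (TetraPoset n) :=
  {x | IsNonContracted c (joinIrred x)}

end CatalanASM

/-!
The lattice of alternating sign matrices and the Stanley lattice are finite distributive lattices,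
hence lattices of lower sets: of the tetrahedron (`asmLowerSetIso`) and of the triangle
(`dyckLowerSetIso`). Indeed the height function of `joinIrred x` is a pyramid
(`heightMatrix_joinIrred`), and since height functions are 1-Lipschitz, `joinIrred x ≤ A` says only
that the height function of `A` is large enough at one corner (`joinIrred_le_iff`). Each
combination of a corner with a possible height above the minimum comes from exactly one `x`, so
`A` is determined by the `x` with `joinIrred x ≤ A`. Dyck paths are treated in the same way, with
peaks in place of pyramids.

A congruence of the lattice of lower sets of a finite poset `T` amounts to the choice of the set
`S ⊆ T` of noncontracted join irreducibles, and its quotient is the lattice of lower sets of `S`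
(`conOfSet_nonContracted`, `nonempty_latticeQuotient_conOfSet`). As a finite poset can be recovered
from its lattice of lower sets, catalan congruences correspond to walls
(`isWall_iff_nonempty_quotient_iso`).

It remains to describe the walls. Given an order embedding of the triangle into the tetrahedron,
every point of the triangle lies on a chain of the largest size possible in the tetrahedron, so
ranks are preserved (`rank_of_orderEmbedding`). The minimal elements of either poset form a path
`0, …, n - 2`, in which neighbours are the pairs with a common upper bound of rank one; so the
embedding acts on minimal elements by the identity or the reversal. The projection of the image of
a point is determined by the minimal elements below it, and therefore, up to the reflection of the
triangle, the embedding is a section of the projection (`proj_of_orderEmbedding`). Its depth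
`x3 - x2` changes by exactly one along each cover relation, because the rank `x2 + x3` increases by
one while neither `x2` nor `x3` decreases; this is a depth triangle (`IsWall.exists_depthSet_eq`).
Conversely, the points at the depths prescribed by a depth triangle form a wall
(`IsDepthTriangle.isWall_depthSet`).
-/

namespace CatalanASM

/-! ### Congruences of finite distributive lattices -/

section Congruence

variable {L T : Type*} [Lattice L] [PartialOrder T]

/-- The congruence of a lattice `L ≃o LowerSet T` attached to a set `S ⊆ T`: two elements are
congruent when the corresponding lower sets agree on `S`. -/
def conOfSet (E : L ≃o LowerSet T) (S : Set T) : LatticeCon L where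
  r a b := ∀ x ∈ S, x ∈ E a ↔ x ∈ E b
  iseqv := ⟨fun _ _ _ => Iff.rfl, fun h x hx => (h x hx).symm,
    fun h k x hx => (h x hx).trans (k x hx)⟩
  inf h k x hx := by simp only [map_inf, LowerSet.mem_inf_iff, h x hx, k x hx]
  sup h k x hx := by simp only [map_sup, LowerSet.mem_sup_iff, h x hx, k x hx]

/-- The trace on `S` of a lower set of `T`. -/
def lowerTrace (S : Set T) (U : LowerSet T) : LowerSet S :=
  ⟨{x | x.1 ∈ U}, fun _ _ h hx => U.lower h hx⟩

theorem mem_lowerTrace {S : Set T} {U : LowerSet T} {x : S} :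
    x ∈ lowerTrace S U ↔ x.1 ∈ U := Iff.rfl

theorem lowerTrace_surjective (S : Set T) : Function.Surjective (lowerTrace S) := by
  intro V
  refine ⟨lowerClosure (Subtype.val '' (V : Set S)), ?_⟩
  ext x
  simp only [SetLike.mem_coe, mem_lowerTrace, mem_lowerClosure]
  constructor
  · rintro ⟨_, ⟨z, hz, rfl⟩, hxz⟩
    exact V.lower hxz hz
  · exact fun hx => ⟨x, ⟨x, hx, rfl⟩, le_rfl⟩

/-- The quotient of `L` by the congruence attached to `S` is the lattice of lower sets of `S`. -/
theorem nonempty_latticeQuotient_conOfSet (E : L ≃o LowerSet T) (S : Set T) :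
    Nonempty (LatticeQuotient (conOfSet E S) ≃o LowerSet S) := by
  have key : ∀ a b : L, (conOfSet E S).r a b ↔ lowerTrace S (E a) = lowerTrace S (E b) := by
    intro a b
    constructor
    · intro h
      ext x
      exact h x.1 x.2
    · intro h x hx
      exact (SetLike.ext_iff.1 h ⟨x, hx⟩ :)
  let f : LatticeQuotient (conOfSet E S) → LowerSet S :=
    Quotient.lift (fun a => lowerTrace S (E a)) fun a b h => (key a b).1 h
  have hf : Function.Bijective f := by
    constructor
    · intro X Y
      induction X using Quotient.inductionOn
      induction Y using Quotient.inductionOn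
      exact fun h => Quotient.sound ((key _ _).2 h)
    · intro V
      obtain ⟨U, hU⟩ := lowerTrace_surjective S V
      exact ⟨Quotient.mk _ (E.symm U), by simpa [f] using hU⟩
  refine ⟨⟨Equiv.ofBijective f hf, ?_⟩⟩
  intro X Y
  induction X using Quotient.inductionOn with | _ a
  induction Y using Quotient.inductionOn with | _ b
  constructor
  · -- `a` is congruent to `a ⊓ b` when the trace of `a` is contained in that of `b`
    intro h
    refine ⟨a ⊓ b, b, Quotient.sound fun x hx => ?_, rfl, inf_le_right⟩
    rw [map_inf, LowerSet.mem_inf_iff, and_iff_left_iff_imp]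
    exact fun hxa => h (show (⟨x, hx⟩ : S) ∈ lowerTrace S (E a) from hxa)
  · rintro ⟨a', b', ha, hb, hab⟩
    rw [← ha, ← hb]
    exact fun x hx => E.monotone hab hx

theorem covBy_Iic_iff {x : T} {B : LowerSet T} : B ⋖ LowerSet.Iic x ↔ B = LowerSet.Iio x := by
  have h1 : ∀ C : LowerSet T, C < LowerSet.Iic x → C ≤ LowerSet.Iio x := by
    intro C hC z hz
    have hzx : z ≤ x := hC.le hz
    refine lt_of_le_of_ne hzx ?_
    rintro rfl
    exact hC.not_ge (LowerSet.Iic_le.2 hz)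
  have h2 : LowerSet.Iio x < LowerSet.Iic x := by
    refine lt_of_le_of_ne (fun z hz => le_of_lt hz) fun h => ?_
    have : x ∈ LowerSet.Iio x := h ▸ (le_refl x)
    exact lt_irrefl x this
  constructor
  · intro h
    exact eq_of_le_of_not_lt (h1 B h.lt) fun hlt => h.2 hlt h2
  · rintro rfl
    exact ⟨h2, fun C hC hC' => (h1 C hC').not_gt hC⟩

theorem isNonContracted_symm_Iic (E : L ≃o LowerSet T) (c : LatticeCon L) (x : T) :
    IsNonContracted c (E.symm (LowerSet.Iic x)) ↔
      ¬ c.r (E.symm (LowerSet.Iic x)) (E.symm (LowerSet.Iio x)) := by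
  have hcov : ∀ b, b ⋖ E.symm (LowerSet.Iic x) ↔ b = E.symm (LowerSet.Iio x) := by
    intro b
    rw [← apply_covBy_apply_iff E, E.apply_symm_apply, covBy_Iic_iff, E.eq_symm_apply]
  constructor
  · rintro ⟨b, hb, hc⟩
    rwa [← (hb _).1 ((hcov _).2 rfl)] at hc
  · exact fun h => ⟨_, hcov, h⟩

theorem not_conOfSet_r_Iio (E : L ≃o LowerSet T) (S : Set T) (x : T) :
    ¬ (conOfSet E S).r (E.symm (LowerSet.Iic x)) (E.symm (LowerSet.Iio x)) ↔ x ∈ S := by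
  constructor
  · intro h
    by_contra hx
    refine h fun z hz => ?_
    have hne : z ≠ x := fun e => hx (e ▸ hz)
    simp only [E.apply_symm_apply, LowerSet.mem_Iic_iff, LowerSet.mem_Iio_iff]
    exact ⟨fun h => lt_of_le_of_ne h hne, le_of_lt⟩
  · intro hx h
    have := h x hx
    simp at this

/-- A join irreducible below `a` but not below a congruent element `b` is contracted. -/
theorem r_Iio_of_mem_of_notMem (E : L ≃o LowerSet T) (c : LatticeCon L) {a b : L} (h : c.r a b)
    {x : T} (ha : x ∈ E a) (hb : x ∉ E b) :
    c.r (E.symm (LowerSet.Iic x)) (E.symm (LowerSet.Iio x)) := by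
  set j := E.symm (LowerSet.Iic x) with hj
  set j' := E.symm (LowerSet.Iio x) with hj'
  have e1 : j ⊓ a = j := inf_eq_left.2 (by
    rw [hj, E.symm_apply_le]; exact LowerSet.Iic_le.2 ha)
  have e2 : j' ⊔ j = j := sup_eq_right.2 (E.symm.monotone fun z hz => le_of_lt hz)
  have e3 : j' ⊔ (j ⊓ b) = j' := sup_eq_left.2 (by
    rw [hj', E.le_symm_apply, map_inf, hj, E.apply_symm_apply]
    intro z hz
    have hz' := LowerSet.mem_inf_iff.1 hz
    refine lt_of_le_of_ne hz'.1 ?_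
    rintro rfl
    exact hb hz'.2)
  have := c.sup (c.refl j') (c.inf (c.refl j) h)
  rwa [e1, e2, e3] at this

/-- Two comparable elements whose lower sets differ by contracted points only are congruent: the
contracted join irreducibles are added one at a time, in an order that respects `T`. -/
theorem r_of_le_of_contracted [Finite T] (E : L ≃o LowerSet T) (c : LatticeCon L) {a b : L}
    (hab : a ≤ b) (h : ∀ x ∈ E b, x ∉ E a →
      c.r (E.symm (LowerSet.Iic x)) (E.symm (LowerSet.Iio x))) : c.r a b := by
  induction hk : ((E b : Set T) \ E a).ncard using Nat.strong_induction_on generalizing a with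
  | _ k ih =>
    have hfin : ((E b : Set T) \ E a).Finite := Set.toFinite _
    rcases Set.eq_empty_or_nonempty ((E b : Set T) \ E a) with he | hne
    · have : a = b := le_antisymm hab (E.le_iff_le.1 (Set.sdiff_eq_empty.1 he))
      rw [this]
    · obtain ⟨x, hx⟩ := hfin.exists_minimal hne
      set j := E.symm (LowerSet.Iic x) with hj
      set j' := E.symm (LowerSet.Iio x) with hj'
      have e1 : a ⊔ j' = a := sup_eq_left.2 (by
        rw [hj', E.symm_apply_le]
        intro z hz
        by_contra hza
        have hzx : z < x := hz
        exact hx.not_lt ⟨(E b).lower hzx.le hx.prop.1, hza⟩ hzx)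
      have h1 : c.r a (a ⊔ j) := by
        have := c.sup (c.refl a) (c.symm (h x hx.prop.1 hx.prop.2))
        rwa [e1] at this
      have hjb : a ⊔ j ≤ b := sup_le hab (by
        rw [hj, E.symm_apply_le]; exact LowerSet.Iic_le.2 hx.prop.1)
      have hmono : ∀ z, z ∈ E a → z ∈ E (a ⊔ j) := fun z hz => E.monotone le_sup_left hz
      refine c.trans h1 (ih _ ?_ hjb (fun z hz hz' => h z hz fun hza => hz' (hmono z hza)) rfl)
      rw [← hk]
      apply Set.ncard_lt_ncard _ hfin
      refine ⟨fun z hz => ⟨hz.1, fun hza => hz.2 (hmono z hza)⟩, fun hsub => ?_⟩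
      apply (hsub hx.prop).2
      simp [hj]

/-- A congruence is determined by its set of noncontracted join irreducibles. -/
theorem conOfSet_nonContracted [Finite T] (E : L ≃o LowerSet T) (c : LatticeCon L) :
    conOfSet E {x | ¬ c.r (E.symm (LowerSet.Iic x)) (E.symm (LowerSet.Iio x))} = c := by
  have key : ∀ a b : L, (conOfSet E
      {x | ¬ c.r (E.symm (LowerSet.Iic x)) (E.symm (LowerSet.Iio x))}).r a b ↔ c.r a b := by
    intro a b
    constructor
    · intro h
      have h1 : c.r (a ⊓ b) a := by
        refine r_of_le_of_contracted E c inf_le_left fun x hx hx' => ?_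
        by_contra hc
        rw [map_inf, LowerSet.mem_inf_iff] at hx'
        exact hx' ⟨hx, (h x hc).1 hx⟩
      have h2 : c.r (a ⊓ b) b := by
        refine r_of_le_of_contracted E c inf_le_right fun x hx hx' => ?_
        by_contra hc
        rw [map_inf, LowerSet.mem_inf_iff] at hx'
        exact hx' ⟨(h x hc).2 hx, hx⟩
      exact c.trans (c.symm h1) h2
    · intro h x hx
      constructor
      · intro ha
        by_contra hb
        exact hx (r_Iio_of_mem_of_notMem E c h ha hb)
      · intro hb
        by_contra ha
        exact hx (r_Iio_of_mem_of_notMem E c (c.symm h) hb ha)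
  have hext : ∀ d : LatticeCon L, (∀ a b, d.r a b ↔ c.r a b) → d = c := by
    intro d hd
    have hs : d.toSetoid = c.toSetoid := Setoid.ext hd
    cases d
    cases c
    cases hs
    rfl
  exact hext _ key

end Congruence

/-! ### Recognizing lattices of lower sets -/

/-- A map to the lower sets of a finite poset is surjective as soon as its range contains
the empty set and the principal lower sets and is closed under unions. -/
theorem surjective_lowerSet_of_generators {L T : Type*} [PartialOrder T] [Finite T]
    (D : L → LowerSet T) (hbot : ∃ a, D a = ⊥) (hsup : ∀ a b, ∃ c, D c = D a ⊔ D b)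
    (hIic : ∀ x, ∃ a, D a = LowerSet.Iic x) : Function.Surjective D := by
  classical
  intro U
  have key : ∀ s : Finset T, ∃ a, D a = s.sup LowerSet.Iic := by
    intro s
    induction s using Finset.induction_on with
    | empty => simpa using hbot
    | insert x s _ ih =>
      obtain ⟨a, ha⟩ := ih
      obtain ⟨b, hb⟩ := hIic x
      obtain ⟨c, hc⟩ := hsup b a
      exact ⟨c, by rw [hc, ha, hb, Finset.sup_insert]⟩
  obtain ⟨a, ha⟩ := key (Set.toFinite (U : Set T)).toFinset
  refine ⟨a, ha.trans (le_antisymm (Finset.sup_le fun x hx => ?_) fun x hx => ?_)⟩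
  · exact LowerSet.Iic_le.2 (by simpa using hx)
  · have hx' : x ∈ (Set.toFinite (U : Set T)).toFinset := by simpa using hx
    have hle : LowerSet.Iic x ≤ _ := Finset.le_sup (f := LowerSet.Iic) hx'
    exact LowerSet.Iic_le.1 hle

/-- Finite posets with isomorphic lattices of lower sets are isomorphic, since each is the poset of
join irreducibles of its lattice of lower sets. -/
theorem nonempty_orderIso_of_lowerSet {S T : Type*} [PartialOrder S] [PartialOrder T] [Finite S]
    [Finite T] (e : LowerSet S ≃o LowerSet T) : Nonempty (S ≃o T) := by
  have h1 : ∀ U : LowerSet S, SupIrred U → SupIrred (e U) := by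
    rintro U ⟨hm, hi⟩
    refine ⟨fun h => hm ?_, fun B C hBC => ?_⟩
    · exact (isMin_iff_eq_bot.2 (by simpa using h.eq_bot))
    · have := @hi (e.symm B) (e.symm C) (by rw [← map_sup, hBC, e.symm_apply_apply])
      rwa [e.symm_apply_eq, e.symm_apply_eq] at this
  have h2 : ∀ U : LowerSet S, SupIrred (e U) → SupIrred U := by
    rintro U ⟨hm, hi⟩
    refine ⟨fun h => hm ?_, fun B C hBC => ?_⟩
    · exact (isMin_iff_eq_bot.2 (by simpa using h.eq_bot))
    · have := @hi (e B) (e C) (by rw [← map_sup, hBC])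
      rwa [e.apply_eq_iff_eq, e.apply_eq_iff_eq] at this
  let e' : {U : LowerSet S // SupIrred U} ≃o {V : LowerSet T // SupIrred V} :=
    { toEquiv := e.toEquiv.subtypeEquiv fun U => ⟨h1 U, h2 U⟩
      map_rel_iff' := e.le_iff_le }
  exact ⟨OrderIso.supIrredLowerSet.trans (e'.trans OrderIso.supIrredLowerSet.symm)⟩

/-! ### Walls and depth triangles -/

instance (n : ℕ) : Finite (TrianglePoset n) :=
  Finite.of_injective
    (fun y => ((⟨y.y1, by have := y.sum_eq; omega⟩ : Fin n),
      (⟨y.y2, by have := y.sum_eq; omega⟩ : Fin n)))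
    fun y z h => by
      have := y.sum_eq
      have := z.sum_eq
      simp only [Prod.mk.injEq, Fin.mk.injEq] at h
      ext <;> omega

instance (n : ℕ) : Finite (TetraPoset n) :=
  Finite.of_injective
    (fun x => ((⟨x.x1, by have := x.sum_eq; omega⟩ : Fin n),
      (⟨x.x2, by have := x.sum_eq; omega⟩ : Fin n), (⟨x.x3, by have := x.sum_eq; omega⟩ : Fin n)))
    fun x w h => by
      have := x.sum_eq
      have := w.sum_eq
      simp only [Prod.mk.injEq, Fin.mk.injEq] at h
      ext <;> omega

theorem TrianglePoset.le_iff {n : ℕ} {y z : TrianglePoset n} :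
    y ≤ z ↔ z.y1 ≤ y.y1 ∧ z.y3 ≤ y.y3 := by
  have := y.sum_eq
  have := z.sum_eq
  change y.y1 + y.y2 ≤ z.y1 + z.y2 ∧ y.y2 + y.y3 ≤ z.y2 + z.y3 ↔ _
  omega

theorem TetraPoset.le_iff {n : ℕ} {x w : TetraPoset n} :
    x ≤ w ↔ w.x1 ≤ x.x1 ∧ x.x2 ≤ w.x2 ∧ x.x3 ≤ w.x3 ∧ w.x4 ≤ x.x4 := Iff.rfl

/-- The reflection of the triangle. -/
def TrianglePoset.reflect (n : ℕ) : TrianglePoset n ≃o TrianglePoset n where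
  toFun y := ⟨y.y3, y.y2, y.y1, by have := y.sum_eq; omega⟩
  invFun y := ⟨y.y3, y.y2, y.y1, by have := y.sum_eq; omega⟩
  left_inv _ := rfl
  right_inv _ := rfl
  map_rel_iff' := by
    intro y z
    simp only [TrianglePoset.le_iff, Equiv.coe_fn_mk]
    exact and_comm

/-- The set of points of the tetrahedron at the depths prescribed by `d`. -/
def depthSet {n : ℕ} (d : TrianglePoset n → ℤ) : Set (TetraPoset n) :=
  {x | d x.proj = (x.x3 : ℤ) - (x.x2 : ℤ)}

theorem mem_depthSet {n : ℕ} {d : TrianglePoset n → ℤ} {x : TetraPoset n} :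
    x ∈ depthSet d ↔ d x.proj = (x.x3 : ℤ) - (x.x2 : ℤ) := Iff.rfl

theorem IsDepthTriangle.exists_split {n : ℕ} {d : TrianglePoset n → ℤ} (hd : IsDepthTriangle d)
    (y : TrianglePoset n) : ∃ a b : ℕ, a + b = y.y2 ∧ d y = (b : ℤ) - a := by
  induction hk : y.y2 generalizing y with
  | zero => exact ⟨0, 0, rfl, by simpa using hd.bottom y hk⟩
  | succ k ih =>
    have := y.sum_eq
    let z : TrianglePoset n := ⟨y.y1, k, y.y3 + 1, by omega⟩
    obtain ⟨a, b, hab, hz⟩ := ih z rfl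
    rcases abs_one_iff.1 (hd.right y z rfl hk.symm rfl) with h | h
    · exact ⟨a, b + 1, by omega, by push_cast; omega⟩
    · exact ⟨a + 1, b, by omega, by push_cast; omega⟩

/-- A depth triangle is 1-Lipschitz along the order, so its graph is a copy of the triangle. -/
theorem IsDepthTriangle.abs_sub_le {n : ℕ} {d : TrianglePoset n → ℤ} (hd : IsDepthTriangle d)
    {y z : TrianglePoset n} (h : y ≤ z) : |d z - d y| ≤ (z.y2 : ℤ) - y.y2 := by
  have hy := y.sum_eq
  induction hk : z.y2 generalizing z with
  | zero =>
    have hz := z.sum_eq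
    have h' := TrianglePoset.le_iff.1 h
    have : y = z := by ext <;> omega
    subst this
    simp [hk]
  | succ k ih =>
    have hz := z.sum_eq
    have h' := TrianglePoset.le_iff.1 h
    by_cases h1 : z.y1 < y.y1
    · let w : TrianglePoset n := ⟨z.y1 + 1, k, z.y3, by omega⟩
      have hw : y ≤ w := TrianglePoset.le_iff.2 ⟨h1, h'.2⟩
      have i1 := ih hw rfl
      have i2 := hd.left z w rfl hk.symm rfl
      rw [abs_le] at i1 ⊢
      rw [abs_one_iff] at i2
      push_cast
      omega
    · by_cases h3 : z.y3 < y.y3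
      · let w : TrianglePoset n := ⟨z.y1, k, z.y3 + 1, by omega⟩
        have hw : y ≤ w := TrianglePoset.le_iff.2 ⟨h'.1, h3⟩
        have i1 := ih hw rfl
        have i2 := hd.right z w rfl hk.symm rfl
        rw [abs_le] at i1 ⊢
        rw [abs_one_iff] at i2
        push_cast
        omega
      · have : y = z := by ext <;> omega
        subst this
        simp [hk]

theorem IsDepthTriangle.exists_mem_depthSet {n : ℕ} {d : TrianglePoset n → ℤ}
    (hd : IsDepthTriangle d) (y : TrianglePoset n) : ∃ x ∈ depthSet d, x.proj = y := by
  obtain ⟨a, b, hab, hy⟩ := hd.exists_split y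
  have hp : (⟨y.y1, a, b, y.y3, by have := y.sum_eq; omega⟩ : TetraPoset n).proj = y :=
    TrianglePoset.ext rfl hab rfl
  exact ⟨_, by rw [mem_depthSet, hp, hy], hp⟩

theorem eq_of_mem_depthSet {n : ℕ} {d : TrianglePoset n → ℤ} {x w : TetraPoset n}
    (hx : x ∈ depthSet d) (hw : w ∈ depthSet d) (h : x.proj = w.proj) : x = w := by
  rw [mem_depthSet] at hx hw
  rw [h] at hx
  have h1 : x.x1 = w.x1 := congrArg TrianglePoset.y1 h
  have h2 : x.x2 + x.x3 = w.x2 + w.x3 := congrArg TrianglePoset.y2 h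
  have h3 : x.x4 = w.x4 := congrArg TrianglePoset.y3 h
  ext <;> omega

theorem TetraPoset.proj_monotone {n : ℕ} : Monotone (TetraPoset.proj : TetraPoset n → _) :=
  fun _ _ h => TrianglePoset.le_iff.2 ⟨h.1, h.2.2.2⟩

theorem IsDepthTriangle.isWall_depthSet {n : ℕ} {d : TrianglePoset n → ℤ}
    (hd : IsDepthTriangle d) : IsWall (depthSet d) := by
  refine ⟨⟨Equiv.ofBijective (fun x => x.1.proj) ⟨fun x w h => ?_, fun y => ?_⟩, ?_⟩⟩
  · exact Subtype.ext (eq_of_mem_depthSet x.2 w.2 h)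
  · obtain ⟨x, hx, hp⟩ := hd.exists_mem_depthSet y
    exact ⟨⟨x, hx⟩, hp⟩
  · rintro ⟨x, hx⟩ ⟨w, hw⟩
    refine ⟨fun h => ?_, fun h => TetraPoset.proj_monotone h⟩
    have h' : x.proj ≤ w.proj := h
    have hab := hd.abs_sub_le h'
    rw [mem_depthSet.1 hx, mem_depthSet.1 hw, abs_le] at hab
    obtain ⟨h1, h3⟩ := TrianglePoset.le_iff.1 h'
    simp only [TetraPoset.proj] at hab h1 h3
    push_cast at hab
    exact (show x ≤ w from ⟨h1, by omega, by omega, h3⟩)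

/-- An order embedding of the triangle into the tetrahedron preserves ranks: every point of the
triangle lies on a chain with `n - 1` elements, the largest size of a chain in either poset. -/
theorem rank_of_orderEmbedding {n : ℕ} (f : TrianglePoset n ↪o TetraPoset n)
    (y : TrianglePoset n) : (f y).x2 + (f y).x3 = y.y2 := by
  have mono : ∀ {y z : TrianglePoset n}, z.y1 ≤ y.y1 → z.y3 ≤ y.y3 → y.y2 < z.y2 →
      (f y).x2 + (f y).x3 < (f z).x2 + (f z).x3 := by
    intro y z h1 h3 h2
    have hlt : f y < f z := f.lt_iff_lt.2 (lt_of_le_of_ne (TrianglePoset.le_iff.2 ⟨h1, h3⟩)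
      fun e => h2.ne (congrArg TrianglePoset.y2 e))
    have hle := TetraPoset.le_iff.1 hlt.le
    have := (f y).sum_eq
    have := (f z).sum_eq
    by_contra hcon
    exact hlt.ne (by ext <;> omega)
  have lower : ∀ k, ∀ y : TrianglePoset n, y.y2 = k → k ≤ (f y).x2 + (f y).x3 := by
    intro k
    induction k with
    | zero => exact fun _ _ => Nat.zero_le _
    | succ k ih =>
      intro y hk
      have := y.sum_eq
      let z : TrianglePoset n := ⟨y.y1, k, y.y3 + 1, by omega⟩
      have i1 := ih z rfl
      have i2 := mono (y := z) (z := y) le_rfl (Nat.le_succ _) (by change k < _; omega)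
      omega
  have upper : ∀ k, ∀ y : TrianglePoset n, y.y1 + y.y3 = k →
      (f y).x2 + (f y).x3 + k + 2 ≤ n := by
    intro k
    induction k with
    | zero => intro y _; have := (f y).sum_eq; omega
    | succ k ih =>
      intro y hk
      have := y.sum_eq
      by_cases h1 : y.y1 = 0
      · let z : TrianglePoset n := ⟨y.y1, y.y2 + 1, y.y3 - 1, by omega⟩
        have i1 := ih z (by change y.y1 + (y.y3 - 1) = k; omega)
        have i2 := mono (y := y) (z := z) le_rfl (Nat.sub_le _ _) (Nat.lt_succ_self _)
        omega
      · let z : TrianglePoset n := ⟨y.y1 - 1, y.y2 + 1, y.y3, by omega⟩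
        have i1 := ih z (by change y.y1 - 1 + y.y3 = k; omega)
        have i2 := mono (y := y) (z := z) (Nat.sub_le _ _) le_rfl (Nat.lt_succ_self _)
        omega
  have := y.sum_eq
  have := lower _ y rfl
  have := upper _ y rfl
  omega

/-- A path on `{0, …, m}` that moves by single steps and never repeats a value is the identity or
the reversal. -/
theorem eq_id_or_reverse_of_adjacent {m : ℕ} {g : ℕ → ℕ} (hle : ∀ a ≤ m, g a ≤ m)
    (hadj : ∀ a < m, g (a + 1) = g a + 1 ∨ g a = g (a + 1) + 1)
    (hinj : ∀ a, a + 2 ≤ m → g (a + 2) ≠ g a) :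
    (∀ a ≤ m, g a = a) ∨ (∀ a ≤ m, g a + a = m) := by
  rcases Nat.eq_zero_or_pos m with rfl | hm
  · exact Or.inl fun a ha => by have := hle a ha; omega
  · rcases hadj 0 hm with h | h
    · left
      have key : ∀ a, a < m → g a = g 0 + a ∧ g (a + 1) = g 0 + a + 1 := by
        intro a
        induction a with
        | zero => intro _; simpa using h
        | succ a ih =>
          intro ha
          have := ih (by omega)
          have := hadj (a + 1) ha
          have := hinj a (by omega)
          simp only [add_assoc, Nat.reduceAdd] at *
          omega
      have h0 := key (m - 1) (by omega)
      rw [Nat.sub_add_cancel hm] at h0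
      have := hle m le_rfl
      intro a ha
      rcases ha.eq_or_lt with rfl | ha
      · omega
      · have := key a ha
        omega
    · right
      have key : ∀ a, a < m → g a + a = g 0 ∧ g (a + 1) + a + 1 = g 0 := by
        intro a
        induction a with
        | zero => intro _; simpa using h.symm
        | succ a ih =>
          intro ha
          have := ih (by omega)
          have := hadj (a + 1) ha
          have := hinj a (by omega)
          simp only [add_assoc, Nat.reduceAdd] at *
          omega
      have h0 := key (m - 1) (by omega)
      rw [Nat.sub_add_cancel hm] at h0
      have := hle 0 (Nat.zero_le _)
      intro a ha
      rcases ha.eq_or_lt with rfl | ha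
      · omega
      · have := key a ha
        omega

/-- An embedding that fixes the minimal elements is a section of the projection. -/
theorem proj_of_orderEmbedding_of_minimal {n : ℕ} (f : TrianglePoset n ↪o TetraPoset n)
    (hf : ∀ y, y.y2 = 0 → (f y).x1 = y.y1) (y : TrianglePoset n) : (f y).proj = y := by
  have hy := y.sum_eq
  let u : TrianglePoset n := ⟨y.y1, 0, y.y2 + y.y3, by omega⟩
  let v : TrianglePoset n := ⟨y.y1 + y.y2, 0, y.y3, by omega⟩
  have hu : f u ≤ f y := f.le_iff_le.2 (TrianglePoset.le_iff.2 ⟨le_rfl, Nat.le_add_left _ _⟩)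
  have hv : f v ≤ f y := f.le_iff_le.2 (TrianglePoset.le_iff.2 ⟨Nat.le_add_right _ _, le_rfl⟩)
  have hu1 : (f u).x1 = y.y1 := hf u rfl
  have hv1 : (f v).x1 = y.y1 + y.y2 := hf v rfl
  have hv2 : (f v).x2 + (f v).x3 = 0 := rank_of_orderEmbedding f v
  have hy2 := rank_of_orderEmbedding f y
  have := (f v).sum_eq
  have := (f y).sum_eq
  have hu' := hu.1
  have hv' := hv.2.2.2
  ext <;> simp only [TetraPoset.proj] <;> omega

/-- Up to the reflection of the triangle, an embedding of the triangle into the tetrahedron is a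
section of the projection. On minimal elements an embedding preserves adjacency, because two
minimal elements are adjacent exactly when they have a common upper bound of rank one. -/
theorem proj_of_orderEmbedding {n : ℕ} (f : TrianglePoset n ↪o TetraPoset n) :
    (∀ y, (f y).proj = y) ∨ ∀ y, (f (TrianglePoset.reflect n y)).proj = y := by
  by_cases hn : n < 2
  · exact Or.inl fun y => by have := y.sum_eq; omega
  let p : ℕ → TrianglePoset n := fun a => if h : a ≤ n - 2 then ⟨a, 0, n - 2 - a, by omega⟩
    else ⟨0, 0, n - 2, by omega⟩
  have hp : ∀ y : TrianglePoset n, y.y2 = 0 → p y.y1 = y := by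
    intro y hy
    have := y.sum_eq
    have h : y.y1 ≤ n - 2 := by omega
    simp only [p, h, dif_pos]
    ext <;> simp only <;> omega
  have p1 : ∀ a ≤ n - 2, (p a).y1 = a := fun a h => by simp only [p, h, dif_pos]
  have p2 : ∀ a, (p a).y2 = 0 := fun a => by simp only [p]; split <;> rfl
  have hr : ∀ a, (f (p a)).x2 + (f (p a)).x3 = 0 := fun a =>
    (rank_of_orderEmbedding f (p a)).trans (p2 a)
  have hinj : ∀ a b, a ≤ n - 2 → b ≤ n - 2 → (f (p a)).x1 = (f (p b)).x1 → a = b := by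
    intro a b ha hb h
    have e : f (p a) = f (p b) := by
      have := hr a
      have := hr b
      have := (f (p a)).sum_eq
      have := (f (p b)).sum_eq
      ext <;> omega
    rw [← p1 a ha, ← p1 b hb, f.injective e]
  have hadj : ∀ a < n - 2, (f (p (a + 1))).x1 = (f (p a)).x1 + 1 ∨
      (f (p a)).x1 = (f (p (a + 1))).x1 + 1 := by
    intro a ha
    let w : TrianglePoset n := ⟨a, 1, n - 3 - a, by omega⟩
    have q : ∀ b, b ≤ n - 2 → a ≤ b → b ≤ a + 1 → f (p b) ≤ f w := by
      intro b hb h1 h2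
      refine f.le_iff_le.2 (TrianglePoset.le_iff.2 ⟨by rw [p1 b hb]; exact h1, ?_⟩)
      have := (p b).sum_eq
      have := p1 b hb
      have := p2 b
      change n - 3 - a ≤ _
      omega
    have q1 := TetraPoset.le_iff.1 (q a (by omega) le_rfl (by omega))
    have q2 := TetraPoset.le_iff.1 (q (a + 1) (by omega) (by omega) le_rfl)
    have r1 := hr a
    have r2 := hr (a + 1)
    have r3 : (f w).x2 + (f w).x3 = 1 := rank_of_orderEmbedding f w
    have := (f (p a)).sum_eq
    have := (f (p (a + 1))).sum_eq
    have := (f w).sum_eq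
    have := fun h => hinj a (a + 1) (by omega) (by omega) h
    omega
  rcases eq_id_or_reverse_of_adjacent (m := n - 2) (g := fun a => (f (p a)).x1)
    (fun a _ => by have := (f (p a)).sum_eq; omega) hadj
    (fun a ha h => by have := hinj _ _ ha (by omega) h; omega) with h | h
  · refine Or.inl (proj_of_orderEmbedding_of_minimal f fun y hy => ?_)
    have := h y.y1 (by have := y.sum_eq; omega)
    rwa [hp y hy] at this
  · refine Or.inr (proj_of_orderEmbedding_of_minimal
      ((TrianglePoset.reflect n).toOrderEmbedding.trans f) fun y hy => ?_)
    have hs := y.sum_eq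
    have := h y.y3 (by omega)
    have e := hp (TrianglePoset.reflect n y) hy
    change p y.y3 = _ at e
    simp only [e] at this
    change (f (TrianglePoset.reflect n y)).x1 = y.y1
    omega

theorem IsWall.exists_section {n : ℕ} {P : Set (TetraPoset n)} (hP : IsWall P) :
    ∃ f : TrianglePoset n ≃o P, ∀ y, (f y).1.proj = y := by
  obtain ⟨e⟩ := hP
  rcases proj_of_orderEmbedding (e.symm.toOrderEmbedding.trans (OrderEmbedding.subtype _))
    with h | h
  · exact ⟨e.symm, h⟩
  · exact ⟨(TrianglePoset.reflect n).trans e.symm, h⟩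

theorem IsWall.existsUnique_proj {n : ℕ} {P : Set (TetraPoset n)} (hP : IsWall P)
    (y : TrianglePoset n) : ∃! x : TetraPoset n, x ∈ P ∧ x.proj = y := by
  obtain ⟨f, hf⟩ := hP.exists_section
  refine ⟨f y, ⟨(f y).2, hf y⟩, fun x ⟨hx, hxy⟩ => ?_⟩
  obtain ⟨z, hz⟩ := f.surjective ⟨x, hx⟩
  have h1 := hf z
  rw [hz] at h1
  change x.proj = z at h1
  rw [hxy] at h1
  rw [h1, hz]

theorem IsWall.exists_depthSet_eq {n : ℕ} {P : Set (TetraPoset n)} (hP : IsWall P) :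
    ∃ d : TrianglePoset n → ℤ, IsDepthTriangle d ∧ depthSet d = P := by
  obtain ⟨f, hf⟩ := hP.exists_section
  have c1 : ∀ y, (f y).1.x1 = y.y1 := fun y => congrArg TrianglePoset.y1 (hf y)
  have c2 : ∀ y, (f y).1.x2 + (f y).1.x3 = y.y2 := fun y => congrArg TrianglePoset.y2 (hf y)
  have c3 : ∀ y, (f y).1.x4 = y.y3 := fun y => congrArg TrianglePoset.y3 (hf y)
  let d : TrianglePoset n → ℤ := fun y => ((f y).1.x3 : ℤ) - ((f y).1.x2 : ℤ)
  have step : ∀ y z : TrianglePoset n, y.y1 ≤ z.y1 → y.y3 ≤ z.y3 → z.y2 + 1 = y.y2 →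
      |d y - d z| = 1 := by
    intro y z h1 h3 h2
    have hle : f z ≤ f y := f.le_iff_le.2 (TrianglePoset.le_iff.2 ⟨h1, h3⟩)
    have hle' : (f z).1 ≤ (f y).1 := hle
    obtain ⟨-, k2, k3, -⟩ := TetraPoset.le_iff.1 hle'
    have := c2 y
    have := c2 z
    rw [abs_one_iff]
    simp only [d]
    omega
  refine ⟨d, ⟨fun y hy => ?_, fun y z h1 h2 h3 => step y z h1.ge (by omega) h2,
    fun y z h1 h2 h3 => step y z (by omega) h3.ge h2⟩, ?_⟩
  · have := c2 y
    simp only [d]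
    omega
  · have hmem : ∀ y, (f y).1 ∈ depthSet d := fun y => by rw [mem_depthSet, hf y]
    apply Set.Subset.antisymm
    · intro x hx
      have : x = (f x.proj).1 := eq_of_mem_depthSet hx (hmem _) (hf _).symm
      rw [this]
      exact (f x.proj).2
    · intro x hx
      obtain ⟨y, hy⟩ := f.surjective ⟨x, hx⟩
      have := hmem y
      rwa [hy] at this

theorem IsDepthTriangle.depthSet_injective {n : ℕ} {d d' : TrianglePoset n → ℤ}
    (hd : IsDepthTriangle d) (h : depthSet d = depthSet d') : d = d' := by
  funext y
  obtain ⟨x, hx, rfl⟩ := hd.exists_mem_depthSet y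
  have hx' := h ▸ hx
  exact (mem_depthSet.1 hx).trans (mem_depthSet.1 hx').symm

/-! ### Alternating sign matrices as lower sets of the tetrahedron -/

theorem ASM.le_iff {n : ℕ} {A B : ASM n} :
    A ≤ B ↔ ∀ i j, heightMatrix A.1 i j ≤ heightMatrix B.1 i j := Iff.rfl

theorem ASM.heightMatrix_sup {n : ℕ} (A B : ASM n) (i j : Fin (n + 1)) :
    heightMatrix (A ⊔ B).1 i j = max (heightMatrix A.1 i j) (heightMatrix B.1 i j) :=
  congrFun (congrFun (A.2.isHFM.sup B.2.isHFM).heightMatrix_ofHeight i) j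

theorem sub_le_of_unit_steps {n : ℕ} {v : Fin (n + 1) → ℤ}
    (h : ∀ j : Fin n, |v j.succ - v j.castSucc| = 1) (j k : Fin (n + 1)) :
    v j - v k ≤ max ((j : ℕ) - (k : ℕ) : ℤ) ((k : ℕ) - (j : ℕ)) := by
  have key : ∀ k j : Fin (n + 1), j ≤ k →
      v j - v k ≤ (k : ℕ) - (j : ℕ) ∧ v k - v j ≤ (k : ℕ) - (j : ℕ) := by
    intro k
    induction k using Fin.induction with
    | zero => intro j hj; rw [Fin.le_zero_iff.1 hj]; simp
    | succ k ih =>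
      intro j hj
      rcases hj.eq_or_lt with rfl | hlt
      · simp
      · have i1 := ih j (Fin.le_castSucc_iff.2 hlt)
        have i2 := abs_one_iff.1 (h k)
        simp only [Fin.val_succ, Fin.val_castSucc] at i1 ⊢
        push_cast
        omega
  rcases le_total j k with hjk | hjk
  · exact (key k j hjk).1.trans (le_max_right _ _)
  · exact (key j k hjk).2.trans (le_max_left _ _)

theorem IsHFM.sub_le {n : ℕ} {H : Fin (n + 1) → Fin (n + 1) → ℤ} (h : IsHFM H)
    (i j k l : Fin (n + 1)) :
    H i j - H k l ≤ max ((i : ℕ) - (k : ℕ) : ℤ) ((k : ℕ) - (i : ℕ)) +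
      max ((j : ℕ) - (l : ℕ) : ℤ) ((l : ℕ) - (j : ℕ)) := by
  have h1 := sub_le_of_unit_steps (v := fun r => H r j) (fun r => h.col_step r j) i k
  have h2 := sub_le_of_unit_steps (v := fun s => H k s) (fun s => h.row_step k s) j l
  omega

/-- Every height function is at least `|i - j|`, the height function of the identity matrix. -/
theorem IsHFM.lower_bound {n : ℕ} {H : Fin (n + 1) → Fin (n + 1) → ℤ} (h : IsHFM H)
    (i j : Fin (n + 1)) : max ((i : ℕ) - (j : ℕ) : ℤ) ((j : ℕ) - (i : ℕ)) ≤ H i j := by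
  have h1 := h.sub_le i 0 i j
  have h2 := h.sub_le 0 j i j
  rw [h.first_col] at h1
  rw [h.first_row] at h2
  simp only [Fin.val_zero] at h1 h2
  push_cast at h1 h2
  omega

theorem IsHFM.upper_bound {n : ℕ} {H : Fin (n + 1) → Fin (n + 1) → ℤ} (h : IsHFM H)
    (i j : Fin (n + 1)) : H i j ≤ (i : ℕ) + (j : ℕ) ∧ H i j ≤ 2 * n - (i : ℕ) - (j : ℕ) := by
  have h1 := h.sub_le i j i 0
  have h2 := h.sub_le i j i (Fin.last n)
  rw [h.first_col] at h1
  rw [h.last_col] at h2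
  have := j.is_le
  simp only [Fin.val_zero, Fin.val_last] at h1 h2
  push_cast at h1 h2
  omega

/-- The row of the corner at which the height function of `joinIrred x` has its peak. -/
def TetraPoset.peakRow {n : ℕ} (x : TetraPoset n) : Fin (n + 1) :=
  ⟨x.x1 + x.x2 + 1, by have := x.sum_eq; omega⟩

/-- The column of the corner at which the height function of `joinIrred x` has its peak. -/
def TetraPoset.peakCol {n : ℕ} (x : TetraPoset n) : Fin (n + 1) :=
  ⟨x.x1 + x.x3 + 1, by have := x.sum_eq; omega⟩

theorem partialSum_indicator {n : ℕ} (k : Fin n) (j : Fin (n + 1)) :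
    partialSum (fun s => if k = s then (1 : ℤ) else 0) j = if (k : ℕ) < (j : ℕ) then 1 else 0 := by
  simp [partialSum, Fin.lt_def]

theorem heightMatrix_ofPerm_succ {n : ℕ} (σ : Equiv.Perm (Fin n)) (i : Fin n) (j : Fin (n + 1)) :
    heightMatrix (ASM.ofPerm σ).1 i.succ j = heightMatrix (ASM.ofPerm σ).1 i.castSucc j + 1 -
      2 * if (σ i : ℕ) < (j : ℕ) then 1 else 0 := by
  simp only [heightMatrix, cornerSum_eq, partialSum_succ, Fin.val_succ, Fin.val_castSucc,
    ASM.ofPerm, Matrix.of_apply, partialSum_indicator]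
  push_cast
  ring

/-- The height function of `joinIrred x` is a pyramid with peak `x2 + x3 + 2`, cut off from below
by the height function `|i - j|` of the identity matrix. -/
theorem heightMatrix_joinIrred {n : ℕ} (x : TetraPoset n) (i j : Fin (n + 1)) :
    heightMatrix (joinIrred x).1 i j = max (max ((i : ℕ) - (j : ℕ) : ℤ) ((j : ℕ) - (i : ℕ)))
      (x.x2 + x.x3 + 2 - max ((i : ℕ) - (x.x1 + x.x2 + 1) : ℤ) (x.x1 + x.x2 + 1 - (i : ℕ)) -
        max ((j : ℕ) - (x.x1 + x.x3 + 1) : ℤ) (x.x1 + x.x3 + 1 - (j : ℕ))) := by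
  have hs := x.sum_eq
  induction i using Fin.induction with
  | zero =>
    rw [(joinIrred x).2.isHFM.first_row]
    simp only [Fin.val_zero]
    push_cast
    omega
  | succ i ih =>
    rw [joinIrred] at ih ⊢
    rw [heightMatrix_ofPerm_succ, ih]
    have hi := i.is_lt
    have hj := j.is_le
    simp only [bigrassmannian, Equiv.coe_fn_mk, Fin.val_succ, Fin.val_castSucc]
    push_cast
    split_ifs <;> omega

/-- The join irreducible of `x` is the least alternating sign matrix with a certain height at a
certain corner. -/
theorem joinIrred_le_iff {n : ℕ} (x : TetraPoset n) (A : ASM n) :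
    joinIrred x ≤ A ↔ (x.x2 + x.x3 + 2 : ℤ) ≤ heightMatrix A.1 x.peakRow x.peakCol := by
  constructor
  · intro h
    refine le_trans ?_ (ASM.le_iff.1 h _ _)
    rw [heightMatrix_joinIrred]
    simp only [TetraPoset.peakRow, TetraPoset.peakCol]
    push_cast
    omega
  · intro h i j
    have h1 := A.2.isHFM.lower_bound i j
    have h2 := A.2.isHFM.sub_le x.peakRow x.peakCol i j
    change heightMatrix (joinIrred x).1 i j ≤ heightMatrix A.1 i j
    rw [heightMatrix_joinIrred]
    simp only [TetraPoset.peakRow, TetraPoset.peakCol] at h h2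
    push_cast at h2
    omega

theorem joinIrred_le_joinIrred_iff {n : ℕ} (x w : TetraPoset n) :
    joinIrred x ≤ joinIrred w ↔ x ≤ w := by
  have := x.sum_eq
  have := w.sum_eq
  rw [joinIrred_le_iff, heightMatrix_joinIrred, TetraPoset.le_iff]
  simp only [TetraPoset.peakRow, TetraPoset.peakCol]
  push_cast
  omega

theorem joinIrred_le_sup_iff {n : ℕ} (x : TetraPoset n) (A B : ASM n) :
    joinIrred x ≤ A ⊔ B ↔ joinIrred x ≤ A ∨ joinIrred x ≤ B := by
  rw [joinIrred_le_iff, joinIrred_le_iff, joinIrred_le_iff, ASM.heightMatrix_sup, le_max_iff]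

theorem ASM.le_of_joinIrred_le {n : ℕ} {A B : ASM n} (h : ∀ x, joinIrred x ≤ A → joinIrred x ≤ B) :
    A ≤ B := by
  intro i j
  change heightMatrix A.1 i j ≤ heightMatrix B.1 i j
  have hA := A.2.isHFM.lower_bound i j
  have hA' := A.2.isHFM.upper_bound i j
  have hB := B.2.isHFM.lower_bound i j
  obtain ⟨m, hm⟩ := A.2.isHFM.parity i j
  by_contra hcon
  -- `x` is the point whose pyramid has its peak at the corner `(i, j)`, at the height of `A`
  let x : TetraPoset n := ⟨(-m).toNat, (m + (i : ℕ) - 1).toNat, (m + (j : ℕ) - 1).toNat,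
    (n - m - (i : ℕ) - (j : ℕ)).toNat, by omega⟩
  have hi : x.peakRow = i := Fin.ext (by simp only [TetraPoset.peakRow, x]; omega)
  have hj : x.peakCol = j := Fin.ext (by simp only [TetraPoset.peakCol, x]; omega)
  have hx := h x
  rw [joinIrred_le_iff, joinIrred_le_iff, hi, hj] at hx
  simp only [x] at hx
  omega

theorem not_joinIrred_le_one {n : ℕ} (x : TetraPoset n) :
    ¬ joinIrred x ≤ ASM.ofPerm (1 : Equiv.Perm (Fin n)) := by
  have key : ∀ i j : Fin (n + 1), heightMatrix (ASM.ofPerm (1 : Equiv.Perm (Fin n))).1 i j =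
      max ((i : ℕ) - (j : ℕ) : ℤ) ((j : ℕ) - (i : ℕ)) := by
    intro i j
    induction i using Fin.induction with
    | zero =>
      rw [(ASM.ofPerm _).2.isHFM.first_row]
      simp
    | succ i ih =>
      rw [heightMatrix_ofPerm_succ, ih]
      simp only [Equiv.Perm.coe_one, id_eq, Fin.val_succ, Fin.val_castSucc]
      push_cast
      split_ifs <;> omega
  rw [joinIrred_le_iff, key]
  simp only [TetraPoset.peakRow, TetraPoset.peakCol]
  push_cast
  omega

/-- The lower set of the points whose join irreducible lies below `A`. -/
def ASM.toLowerSet {n : ℕ} (A : ASM n) : LowerSet (TetraPoset n) :=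
  ⟨{x | joinIrred x ≤ A}, fun _ _ h hx => ((joinIrred_le_joinIrred_iff _ _).2 h).trans hx⟩

theorem toLowerSet_joinIrred {n : ℕ} (x : TetraPoset n) :
    (joinIrred x).toLowerSet = LowerSet.Iic x := by
  ext w
  exact joinIrred_le_joinIrred_iff w x

theorem ASM.toLowerSet_surjective (n : ℕ) :
    Function.Surjective (ASM.toLowerSet : ASM n → LowerSet (TetraPoset n)) := by
  refine surjective_lowerSet_of_generators _ ⟨ASM.ofPerm 1, ?_⟩ (fun A B => ⟨A ⊔ B, ?_⟩)
    fun x => ⟨joinIrred x, toLowerSet_joinIrred x⟩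
  · exact eq_bot_iff.2 fun x hx => not_joinIrred_le_one x hx
  · ext x
    exact joinIrred_le_sup_iff x A B

/-- The lattice of alternating sign matrices is the lattice of lower sets of the tetrahedron. -/
noncomputable def asmLowerSetIso (n : ℕ) : ASM n ≃o LowerSet (TetraPoset n) :=
  RelIso.ofSurjective (OrderEmbedding.ofMapLEIff ASM.toLowerSet fun _ _ =>
    ⟨fun h => ASM.le_of_joinIrred_le fun _ hx => h hx, fun h _ hx => le_trans hx h⟩)
    (ASM.toLowerSet_surjective n)

theorem asmLowerSetIso_symm_Iic {n : ℕ} (x : TetraPoset n) :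
    (asmLowerSetIso n).symm (LowerSet.Iic x) = joinIrred x := by
  rw [OrderIso.symm_apply_eq]
  exact (toLowerSet_joinIrred x).symm

/-! ### Dyck paths as lower sets of the triangle -/

/-- The sequences of heights of Dyck paths of semilength `n`. Values at positions beyond `2 * n`
are irrelevant. -/
structure IsDyckHeight (n : ℕ) (g : ℕ → ℤ) : Prop where
  zero : g 0 = 0
  nonneg : ∀ k ≤ 2 * n, 0 ≤ g k
  last : g (2 * n) = 0
  step : ∀ k < 2 * n, |g (k + 1) - g k| = 1

theorem IsDyckHeight.sub_le {n : ℕ} {g : ℕ → ℤ} (hg : IsDyckHeight n g) {k l : ℕ} (hkl : k ≤ l)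
    (hl : l ≤ 2 * n) : g k - g l ≤ (l : ℤ) - k ∧ g l - g k ≤ (l : ℤ) - k := by
  induction l, hkl using Nat.le_induction with
  | base => simp
  | succ l hkl ih =>
    have := ih (by omega)
    have := abs_one_iff.1 (hg.step l (by omega))
    push_cast
    omega

theorem IsDyckHeight.parity {n : ℕ} {g : ℕ → ℤ} (hg : IsDyckHeight n g) {k : ℕ}
    (hk : k ≤ 2 * n) : ∃ m : ℤ, g k = k + 2 * m := by
  induction k with
  | zero => exact ⟨0, by simpa using hg.zero⟩
  | succ k ih =>
    obtain ⟨m, hm⟩ := ih (by omega)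
    rcases abs_one_iff.1 (hg.step k (by omega)) with h | h
    · exact ⟨m, by push_cast; omega⟩
    · exact ⟨m - 1, by push_cast; omega⟩

theorem IsDyckHeight.sup {n : ℕ} {g h : ℕ → ℤ} (hg : IsDyckHeight n g) (hh : IsDyckHeight n h) :
    IsDyckHeight n (fun k => max (g k) (h k)) where
  zero := by simp [hg.zero, hh.zero]
  nonneg k hk := le_max_of_le_left (hg.nonneg k hk)
  last := by simp [hg.last, hh.last]
  step k hk := by
    have h1 := abs_one_iff.1 (hg.step k hk)
    have h2 := abs_one_iff.1 (hh.step k hk)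
    obtain ⟨a, ha⟩ := hg.parity hk.le
    obtain ⟨b, hb⟩ := hh.parity hk.le
    rw [abs_one_iff]
    omega

theorem isDyckHeight_zigzag (n : ℕ) : IsDyckHeight n (fun k => (k : ℤ) % 2) where
  zero := rfl
  nonneg k _ := by omega
  last := by push_cast; omega
  step k _ := by
    rw [abs_one_iff]
    push_cast
    omega

/-- The position of the peak of the Dyck path of a point of the triangle. -/
def TrianglePoset.peak {n : ℕ} (y : TrianglePoset n) : ℕ := 2 * y.y1 + y.y2 + 2

/-- The zigzag path with one peak of height `y2 + 2` added. -/
theorem isDyckHeight_peak {n : ℕ} (y : TrianglePoset n) :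
    IsDyckHeight n (fun k => max ((k : ℤ) % 2)
      (y.y2 + 2 - max ((k : ℤ) - y.peak) (y.peak - (k : ℤ)))) := by
  have := y.sum_eq
  refine ⟨?_, fun k _ => ?_, ?_, fun k hk => ?_⟩
  · simp only [TrianglePoset.peak]
    push_cast
    omega
  · omega
  · simp only [TrianglePoset.peak]
    push_cast
    omega
  · rw [abs_one_iff]
    simp only [TrianglePoset.peak]
    push_cast
    omega

theorem DyckPath.length_eq {n : ℕ} (p : DyckPath n) : p.word.toList.length = 2 * n := by
  rw [← p.word.two_mul_semilength_eq_length, p.semilength_eq]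

theorem DyckPath.height_of_le {n : ℕ} (p : DyckPath n) {k : ℕ} (hk : 2 * n ≤ k) :
    p.height k = 0 := by
  rw [DyckPath.height, List.take_of_length_le (p.length_eq.trans_le hk),
    p.word.count_U_eq_count_D, sub_self]

theorem DyckPath.isDyckHeight {n : ℕ} (p : DyckPath n) : IsDyckHeight n p.height where
  zero := by simp [DyckPath.height]
  nonneg k _ := by
    have := p.word.count_D_le_count_U k
    simp only [DyckPath.height]
    omega
  last := p.height_of_le le_rfl
  step k hk := by
    have hk' : k < p.word.toList.length := by rwa [p.length_eq]
    simp only [DyckPath.height, List.take_add_one, List.getElem?_eq_getElem hk',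
      Option.toList_some, List.count_append, List.count_singleton', abs_one_iff]
    rcases (p.word.toList[k]).dichotomy with a | a <;> simp only [a] <;> simp

theorem IsDyckHeight.exists_dyckPath {n : ℕ} {g : ℕ → ℤ} (hg : IsDyckHeight n g) :
    ∃ p : DyckPath n, ∀ k ≤ 2 * n, p.height k = g k := by
  let s : ℕ → DyckStep := fun k => if g k < g (k + 1) then DyckStep.U else DyckStep.D
  have count : ∀ k ≤ 2 * n, ((((List.range k).map s).count DyckStep.U : ℕ) : ℤ) -
      (((List.range k).map s).count DyckStep.D : ℕ) = g k := by
    intro k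
    induction k with
    | zero => intro _; simp [hg.zero]
    | succ k ih =>
      intro hk
      have i1 := ih (by omega)
      have i2 := abs_one_iff.1 (hg.step k (by omega))
      rw [List.range_succ, List.map_append, List.count_append, List.count_append]
      push_cast
      by_cases h : g k < g (k + 1)
      · have hs : s k = DyckStep.U := if_pos h
        simp only [List.map_singleton, hs, List.count_singleton_self, reduceCtorEq,
          List.count_singleton', if_false]
        push_cast
        omega
      · have hs : s k = DyckStep.D := if_neg h
        simp only [List.map_singleton, hs, List.count_singleton_self, reduceCtorEq,
          List.count_singleton', if_false]
        push_cast
        omega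
  let l := (List.range (2 * n)).map s
  have take : ∀ k, l.take k = (List.range (min k (2 * n))).map s := fun k => by
    simp only [l, ← List.map_take, List.take_range]
  let w : DyckWord := ⟨l, by
    have := count _ le_rfl
    rw [hg.last] at this
    simp only [l]
    omega, fun k => by
    rw [take]
    have := count _ (min_le_right k (2 * n))
    have := hg.nonneg _ (min_le_right k (2 * n))
    omega⟩
  have hw : w.semilength = n := by
    have := w.two_mul_semilength_eq_length
    simp only [w, l, List.length_map, List.length_range] at this ⊢
    omega
  refine ⟨⟨w, hw⟩, fun k hk => ?_⟩
  simp only [DyckPath.height, w]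
  rw [take, min_eq_left hk, count k hk]

/-- The lower set of the points whose peak lies weakly below the path. -/
def DyckPath.toLowerSet {n : ℕ} (p : DyckPath n) : LowerSet (TrianglePoset n) :=
  ⟨{y | (y.y2 + 2 : ℤ) ≤ p.height y.peak}, fun z y hyz hz => by
    have := y.sum_eq
    have := z.sum_eq
    obtain ⟨h1, h3⟩ := TrianglePoset.le_iff.1 hyz
    have hz' : (z.y2 + 2 : ℤ) ≤ p.height z.peak := hz
    change (y.y2 + 2 : ℤ) ≤ p.height y.peak
    rcases le_total z.peak y.peak with h | h
    · have := p.isDyckHeight.sub_le h (by simp only [TrianglePoset.peak]; omega)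
      simp only [TrianglePoset.peak] at *
      omega
    · have := p.isDyckHeight.sub_le h (by simp only [TrianglePoset.peak]; omega)
      simp only [TrianglePoset.peak] at *
      omega⟩

theorem DyckPath.mem_toLowerSet {n : ℕ} {p : DyckPath n} {y : TrianglePoset n} :
    y ∈ p.toLowerSet ↔ (y.y2 + 2 : ℤ) ≤ p.height y.peak := Iff.rfl

theorem TrianglePoset.peak_le {n : ℕ} (y : TrianglePoset n) : y.peak ≤ 2 * n := by
  have := y.sum_eq
  simp only [TrianglePoset.peak]
  omega

theorem DyckPath.toLowerSet_surjective (n : ℕ) :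
    Function.Surjective (DyckPath.toLowerSet : DyckPath n → LowerSet (TrianglePoset n)) := by
  refine surjective_lowerSet_of_generators _ ?_ (fun p q => ?_) fun y => ?_
  · obtain ⟨p, hp⟩ := (isDyckHeight_zigzag n).exists_dyckPath
    refine ⟨p, eq_bot_iff.2 fun y hy => ?_⟩
    rw [SetLike.mem_coe, DyckPath.mem_toLowerSet, hp _ y.peak_le] at hy
    omega
  · obtain ⟨r, hr⟩ := (p.isDyckHeight.sup q.isDyckHeight).exists_dyckPath
    refine ⟨r, ?_⟩
    ext y
    simp only [SetLike.mem_coe, LowerSet.mem_sup_iff, DyckPath.mem_toLowerSet, hr _ y.peak_le,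
      le_max_iff]
  · obtain ⟨p, hp⟩ := (isDyckHeight_peak y).exists_dyckPath
    refine ⟨p, ?_⟩
    ext z
    have := y.sum_eq
    have := z.sum_eq
    rw [SetLike.mem_coe, SetLike.mem_coe, LowerSet.mem_Iic_iff, DyckPath.mem_toLowerSet,
      hp _ z.peak_le, TrianglePoset.le_iff]
    simp only [TrianglePoset.peak]
    push_cast
    omega

theorem DyckPath.toLowerSet_le_iff {n : ℕ} {p q : DyckPath n} :
    p.toLowerSet ≤ q.toLowerSet ↔ p ≤ q := by
  refine ⟨fun h k => ?_, fun h y hy => le_trans hy (h y.peak)⟩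
  rcases le_total (2 * n) k with hk | hk
  · rw [p.height_of_le hk, q.height_of_le hk]
  · change p.height k ≤ q.height k
    have hp0 := p.isDyckHeight.nonneg k hk
    have hq0 := q.isDyckHeight.nonneg k hk
    have hp1 := (p.isDyckHeight.sub_le (Nat.zero_le k) hk).2
    have hp2 := (p.isDyckHeight.sub_le hk le_rfl).1
    rw [p.isDyckHeight.zero] at hp1
    rw [p.isDyckHeight.last] at hp2
    obtain ⟨a, ha⟩ := p.isDyckHeight.parity hk
    obtain ⟨b, hb⟩ := q.isDyckHeight.parity hk
    by_contra hcon
    -- `y` is the point whose peak is at position `k`, at the height of `p`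
    let y : TrianglePoset n := ⟨(-a).toNat, (k + 2 * a - 2).toNat, (n - k - a).toNat, by
      push_cast at hp1 hp2
      omega⟩
    have hy : y.peak = k := by
      simp only [TrianglePoset.peak, y]
      push_cast at hp1 hp2
      omega
    have := @h y
    rw [SetLike.mem_coe, SetLike.mem_coe, DyckPath.mem_toLowerSet, DyckPath.mem_toLowerSet,
      hy] at this
    simp only [y] at this
    omega

/-- The Stanley lattice is the lattice of lower sets of the triangle. -/
noncomputable def dyckLowerSetIso (n : ℕ) : DyckPath n ≃o LowerSet (TrianglePoset n) :=
  RelIso.ofSurjective (OrderEmbedding.ofMapLEIff DyckPath.toLowerSet fun _ _ =>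
    DyckPath.toLowerSet_le_iff) (DyckPath.toLowerSet_surjective n)

/-! ### Catalan congruences and walls -/

theorem wallOf_eq {n : ℕ} (c : LatticeCon (ASM n)) :
    wallOf c = {x | ¬ c.r ((asmLowerSetIso n).symm (LowerSet.Iic x))
      ((asmLowerSetIso n).symm (LowerSet.Iio x))} := by
  ext x
  rw [Set.mem_ofPred_eq, ← isNonContracted_symm_Iic, asmLowerSetIso_symm_Iic]
  rfl

theorem wallOf_conOfSet {n : ℕ} (S : Set (TetraPoset n)) :
    wallOf (conOfSet (asmLowerSetIso n) S) = S := by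
  rw [wallOf_eq]
  ext x
  exact not_conOfSet_r_Iio _ S x

theorem conOfSet_wallOf {n : ℕ} (c : LatticeCon (ASM n)) :
    conOfSet (asmLowerSetIso n) (wallOf c) = c := by
  rw [wallOf_eq]
  exact conOfSet_nonContracted _ c

/-- A congruence is catalan exactly when its noncontracted join irreducibles form a wall: its
quotient is the lattice of lower sets of these join irreducibles, and the Stanley lattice is the
lattice of lower sets of the triangle. -/
theorem isWall_iff_nonempty_quotient_iso {n : ℕ} (S : Set (TetraPoset n)) :
    IsWall S ↔ Nonempty (LatticeQuotient (conOfSet (asmLowerSetIso n) S) ≃o DyckPath n) := by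
  obtain ⟨e⟩ := nonempty_latticeQuotient_conOfSet (asmLowerSetIso n) S
  constructor
  · rintro ⟨f⟩
    exact ⟨e.trans ((LowerSet.map f).trans (dyckLowerSetIso n).symm)⟩
  · rintro ⟨f⟩
    exact nonempty_orderIso_of_lowerSet (e.symm.trans (f.trans (dyckLowerSetIso n)))

theorem CatalanCongruence.isWall_wallOf {n : ℕ} (c : CatalanCongruence n) :
    IsWall (wallOf c.1) := by
  rw [isWall_iff_nonempty_quotient_iso, conOfSet_wallOf]
  exact c.2

/-- The catalan congruence of a depth triangle. -/
noncomputable def DepthTriangle.toCongruence {n : ℕ} (d : DepthTriangle n) : CatalanCongruence n :=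
  ⟨conOfSet (asmLowerSetIso n) (depthSet d.1),
    (isWall_iff_nonempty_quotient_iso _).1 d.2.isWall_depthSet⟩

theorem DepthTriangle.wallOf_toCongruence {n : ℕ} (d : DepthTriangle n) :
    wallOf d.toCongruence.1 = depthSet d.1 := wallOf_conOfSet _

theorem DepthTriangle.toCongruence_bijective (n : ℕ) :
    Function.Bijective (DepthTriangle.toCongruence : DepthTriangle n → CatalanCongruence n) := by
  constructor
  · intro d d' h
    refine Subtype.ext (d.2.depthSet_injective ?_)
    rw [← d.wallOf_toCongruence, h, d'.wallOf_toCongruence]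
  · intro c
    obtain ⟨d, hd, hdc⟩ := c.isWall_wallOf.exists_depthSet_eq
    refine ⟨⟨d, hd⟩, Subtype.ext ?_⟩
    change conOfSet _ (depthSet d) = c.1
    rw [hdc, conOfSet_wallOf]

end CatalanASM

theorem mainTheorem3 (n : ℕ) (hn : 1 ≤ n) :
    (∀ P : Set (CatalanASM.TetraPoset n), CatalanASM.IsWall P →
      ∀ y : CatalanASM.TrianglePoset n, ∃! x : CatalanASM.TetraPoset n, x ∈ P ∧ x.proj = y) ∧
    ∃ Φ : CatalanASM.CatalanCongruence n ≃ CatalanASM.DepthTriangle n,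
      ∀ c : CatalanASM.CatalanCongruence n,
        CatalanASM.IsWall (CatalanASM.wallOf c.1) ∧
        ∀ x : CatalanASM.TetraPoset n,
          x ∈ CatalanASM.wallOf c.1 ↔ (Φ c).1 x.proj = (x.x3 : ℤ) - (x.x2 : ℤ) := by
  refine ⟨fun P hP => hP.existsUnique_proj,
    (Equiv.ofBijective _ (CatalanASM.DepthTriangle.toCongruence_bijective n)).symm,
    fun c => ⟨c.isWall_wallOf, fun x => ?_⟩⟩
  obtain ⟨d, rfl⟩ := (CatalanASM.DepthTriangle.toCongruence_bijective n).2 c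
  have e : (Equiv.ofBijective _ (CatalanASM.DepthTriangle.toCongruence_bijective n)).symm
      d.toCongruence = d := Equiv.ofBijective_symm_apply_apply _ _ d
  rw [e, d.wallOf_toCongruence, CatalanASM.mem_depthSet]
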